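/- Let $\ell^2$ be the real Hilbert space of square-summable sequences. For a set-valued operator $A\colon H\rightrightarrows H$ on a real Hilbert space write $\operatorname{dom}A=\{x: Ax\neq\varnothing\}$, $\operatorname{zer}A=\{x: 0\in Ax\}$, $J_A=(\operatorname{Id}+A)^{-1}$; $A$ is monotone if $\langle x-y,v-w\rangle\ge 0$ whenever $v\in Ax$, $w\in Ay$, and maximally monotone if in addition no monotone operator has a strictly larger graph. There exist a maximally monotone operator $B$ on $\ell^2$ with bounded domain and with $J_B$ single-valued and everywhere defined, a starting point $s_0\in\ell^2$, and a point $\bar s\in\operatorname{zer}B$ such that $(J_B^k s_0)_{k\in\mathbb N}$ converges weakly to $\bar s$ but does not converge strongly. Moreover, the same $B$, $s_0$, $\bar s$ satisfy the following. (i) (Douglas–Rachford with $A_1=B$, $A_2=0$.) On $H=\ell^2\times\ell^2$ let $A(x,y)=(A_1x+y)\times(-x+A_2^{-1}y)$, let $C\colon\ell^2\to H$, $Cw=(w,-w)$, and $M=CC^*$. Then $T=(M+A)^{-1}M$ and $\widetilde T=C^*(M+A)^{-1}C$ are single-valued and everywhere defined, $(\bar s,0)\in\operatorname{zer}A$, and,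 with $u_0=(s_0,0)$ and $w_0=C^*u_0$, the sequences $(T^ku_0)_{k\in\mathbb N}$ and $(\widetilde T^kw_0)_{k\in\mathbb N}$ converge weakly to $(\bar s,0)$ and to $\bar s$, respectively, but neither converges strongly. (ii) (Chambolle–Pock with $A_1=\sigma^{-1}B$, $A_2=0$.) Let $Y$ be any real Hilbert space, $L\colon\ell^2\to Y$ any continuous linear operator, and $\sigma,\tau>0$ with $\sigma\tau\|L\|^2\le 1$. On $\ell^2\times Y$ let $A(x,y)=(A_1x+L^*y)\times(-Lx+A_2^{-1}y)$ and $M(x,y)=(\tfrac1\sigma x-L^*y,\,-Lx+\tfrac1\tau y)$. Then $T=(M+A)^{-1}M$ is single-valued and everywhere defined, $(\bar s,0)\in\operatorname{zer}A$, and $(T^k(s_0,0))_{k\in\mathbb N}$ converges weakly to $(\bar s,0)$ but does not converge strongly. -/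

import Mathlib

open Filter Topology

universe u

noncomputable section

namespace MonotoneOp

section General

variable {H : Type*} [NormedAddCommGroup H] [InnerProductSpace ℝ H]

/-- A set-valued operator `A : H ⇉ H` is a map `H → Set H`. It is monotone if
`⟪x - y, v - w⟫ ≥ 0` whenever `v ∈ A x` and `w ∈ A y`. -/
def IsMonotone (A : H → Set H) : Prop :=
  ∀ ⦃x y v w : H⦄, v ∈ A x → w ∈ A y → 0 ≤ inner ℝ (x - y) (v - w)

/-- `A` is maximally monotone: monotone, and no monotone operator has a strictly larger graph. -/
def IsMaximallyMonotone (A : H → Set H) : Prop :=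
  IsMonotone A ∧ ∀ A' : H → Set H, IsMonotone A' → (∀ x, A x ⊆ A' x) → A' = A

/-- The domain `{x | A x ≠ ∅}`. -/
def dom (A : H → Set H) : Set H := {x | (A x).Nonempty}

/-- The set of zeros `{x | 0 ∈ A x}`. -/
def zer (A : H → Set H) : Set H := {x | 0 ∈ A x}

/-- The set-valued inverse: `x ∈ A⁻¹ v` iff `v ∈ A x`. -/
def inv (A : H → Set H) : H → Set H := fun v => {x | v ∈ A x}

/-- The sum `M + A` of a single-valued map `M` and a set-valued operator `A`:
`v ∈ (M + A) x` iff `v - M x ∈ A x`. -/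
def addMap (M : H → H) (A : H → Set H) : H → Set H := fun x => {v | v - M x ∈ A x}

/-- The operator `c A : x ↦ {c v | v ∈ A x}`. -/
def scale (c : ℝ) (A : H → Set H) : H → Set H := fun x => (fun v => c • v) '' A x

/-- The operator `x ↦ {0}`. -/
def zeroOp (H : Type*) [Zero H] : H → Set H := fun _ => {0}

/-- The resolvent `J_A = (Id + A)⁻¹`, as a set-valued operator. -/
def resolventOp (A : H → Set H) : H → Set H := inv (addMap id A)

/-- Convergence in the weak topology of `H`. -/
def TendstoWeakly (s : ℕ → H) (x : H) : Prop :=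
  Tendsto (fun k => toWeakSpace ℝ H (s k)) atTop (𝓝 (toWeakSpace ℝ H x))

/-- `s` converges weakly to `x` and has no limit in norm. -/
def ConvergesOnlyWeakly (s : ℕ → H) (x : H) : Prop :=
  TendstoWeakly s x ∧ ¬ ∃ y : H, Tendsto s atTop (𝓝 y)

/-- The preconditioned proximal point operator `T = (M + A)⁻¹ M`. -/
def pppOp (M : H → H) (A : H → Set H) : H → Set H := fun z => inv (addMap M A) (M z)

/-- The reduced preconditioned proximal point operator `C* (M + A)⁻¹ C` on `D`,
where `C : D → H` and `M = C C*`. -/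
def reducedOp {D : Type*} [NormedAddCommGroup D] [InnerProductSpace ℝ D]
    [CompleteSpace D] [CompleteSpace H] (C : D →L[ℝ] H) (A : H → Set H) : D → Set D :=
  fun w => C.adjoint '' inv (addMap (C ∘L C.adjoint) A) (C w)

end General

section Splitting

variable {X : Type*} [NormedAddCommGroup X] [InnerProductSpace ℝ X] [CompleteSpace X]
variable {Y : Type*} [NormedAddCommGroup Y] [InnerProductSpace ℝ Y] [CompleteSpace Y]

/-- The block operator `(x, y) ↦ (A₁ x + L* y) × (- L x + A₂⁻¹ y)` on the Hilbert space `X × Y`,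
that is, `v` is in its value at `z` iff `v₁ - L* z₂ ∈ A₁ z₁` and `v₂ + L z₁ ∈ A₂⁻¹ z₂`. -/
def primalDualOp (L : X →L[ℝ] Y) (A₁ : X → Set X) (A₂ : Y → Set Y) :
    WithLp 2 (X × Y) → Set (WithLp 2 (X × Y)) :=
  fun z => {v | v.fst - L.adjoint z.snd ∈ A₁ z.fst ∧ v.snd + L z.fst ∈ inv A₂ z.snd}

/-- Douglas-Rachford: the operator `(x, y) ↦ (A₁ x + y) × (- x + A₂⁻¹ y)` on `X × X`. -/
def drA (A₁ A₂ : X → Set X) : WithLp 2 (X × X) → Set (WithLp 2 (X × X)) :=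
  primalDualOp (ContinuousLinearMap.id ℝ X) A₁ A₂

/-- Douglas-Rachford: the map `C : X → X × X`, `w ↦ (w, -w)`. -/
def drC (X : Type*) [NormedAddCommGroup X] [InnerProductSpace ℝ X] :
    X →L[ℝ] WithLp 2 (X × X) :=
  (WithLp.prodContinuousLinearEquiv 2 ℝ X X).symm.toContinuousLinearMap ∘L
    (ContinuousLinearMap.id ℝ X).prod (-ContinuousLinearMap.id ℝ X)

/-- Douglas-Rachford: the preconditioner `M = C C*`. -/
def drM (X : Type*) [NormedAddCommGroup X] [InnerProductSpace ℝ X] [CompleteSpace X] :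
    WithLp 2 (X × X) → WithLp 2 (X × X) :=
  drC X ∘L (drC X).adjoint

/-- Chambolle-Pock: the preconditioner `M (x, y) = (x / σ - L* y, - L x + y / τ)`. -/
def cpM (L : X →L[ℝ] Y) (σ τ : ℝ) : WithLp 2 (X × Y) → WithLp 2 (X × Y) :=
  fun z => WithLp.toLp 2
    (σ⁻¹ • z.fst - L.adjoint z.snd, - L z.fst + τ⁻¹ • z.snd)

end Splitting

/-- The real Hilbert space `ℓ²` of square-summable sequences. -/
abbrev Ell2 : Type := lp (fun _ : ℕ => ℝ) 2

end MonotoneOp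

end

/-!
Everything reduces to a firmly nonexpansive map `J` with bounded range and `J 0 = 0` having an orbit
`x k` that is weakly null but bounded away from `0` in norm: with `A₂ = 0` both splitting methods
run `J` in the first component and keep the second one at `0`.
The map `J` is the projection onto the closed convex hull of `0` and the points
`(x (k + 1), h k)` of `H × ℝ`, compressed to the first factor. It sends `x k` to
`x (k + 1)` as soon as the residual `(x k - x (k + 1), -h k)` is an outer normal of the hull at
`(x (k + 1), h k)`, so what remains is to choose an orbit and positive heights satisfying these
inequalities.
The orbit runs along `x k = r k • v (a k)`, where `⟪v a, v b⟫ = 2 / (a + b)` is the Cauchy kernel,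
with the heights `h k = r (k + 1) * exp (-a (k + 1))`. The outer normal inequalities then say that
an explicit function of `c` is minimal at `c = a (k + 1)`, and the vanishing of its derivative there
is the recursion that determines `a (k + 1)` from `a k`. Since `a k → ∞`, the orbit is
asymptotically orthogonal to each of its members; since the exponential heights are tiny, the
decrease of `‖x k‖ ^ 2 = r k ^ 2 / a k` is dominated by that of `2 / a k`.
-/

namespace MonotoneOp

open scoped RealInnerProductSpace

section TangentSteps

/-- The parameter `b` is obtained from `a` by a tangent step if `b ∈ [a, a + 1]` and `c = b` is a
critical point of `c ↦ (a + c) * (2 / (b + c) + exp (-b) * exp (-c))`, a condition that is written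
here in solved form. It is what makes `b` the minimizer of this function. -/
structure IsTangentStep (a b : ℝ) : Prop where
  le : a ≤ b
  le_add_one : b ≤ a + 1
  sub_eq : b - a = 2 * b ^ 2 * (a + b - 1) * Real.exp (-b) ^ 2

theorem four_mul_cube_mul_exp_neg_sq_le_one {b : ℝ} (hb : 6 ≤ b) :
    4 * b ^ 3 * Real.exp (-b) ^ 2 ≤ 1 := by
  have hexp : (2 * b) ^ 4 / 24 ≤ Real.exp (2 * b) := by
    simpa [Nat.factorial] using Real.pow_div_factorial_le_exp (2 * b) (by linarith) 4
  have hcube : 4 * b ^ 3 ≤ (2 * b) ^ 4 / 24 := by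
    nlinarith [pow_pos (by linarith : 0 < b) 3]
  rw [← Real.exp_nat_mul, show ((2 : ℕ) : ℝ) * -b = -(2 * b) by push_cast; ring, Real.exp_neg,
    ← div_eq_mul_inv, div_le_one (Real.exp_pos _)]
  exact hcube.trans hexp

theorem exists_isTangentStep {a : ℝ} (ha : 5 ≤ a) : ∃ b, IsTangentStep a b := by
  let f : ℝ → ℝ := fun b => b - a - 2 * b ^ 2 * (a + b - 1) * Real.exp (-b) ^ 2
  have hf : Continuous f := by fun_prop
  have hleft : f a ≤ 0 := by
    have : 0 ≤ 2 * a ^ 2 * (a + a - 1) * Real.exp (-a) ^ 2 := by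
      have : 0 ≤ a + a - 1 := by linarith
      positivity
    linarith
  have hright : 0 ≤ f (a + 1) := by
    have hle := four_mul_cube_mul_exp_neg_sq_le_one (b := a + 1) (by linarith)
    have : 0 ≤ 4 * (a + 1) ^ 2 * Real.exp (-(a + 1)) ^ 2 := by positivity
    simp only [f]
    linarith
  obtain ⟨b, ⟨hab, hba⟩, hb⟩ :=
    intermediate_value_Icc (by linarith) hf.continuousOn (Set.mem_Icc.2 ⟨hleft, hright⟩)
  exact ⟨b, hab, hba, sub_eq_zero.1 hb⟩

theorem tangent_defect_nonneg {b m d : ℝ} (hb : 13 ≤ b) (hm : 2 * b - 1 ≤ m) (hm' : m ≤ 2 * b)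
    (hd : -b ≤ d) :
    0 ≤ (m + d) * Real.exp (-d) - m + 2 * b * (m - 1) * d / (2 * b + d) := by
  have hpos : 0 < 2 * b + d := by linarith
  rcases le_total d 2 with h2 | h2
  · have hexp : (1 - d / 2) ^ 2 ≤ Real.exp (-d) := by
      simpa using Real.one_sub_div_pow_le_exp_neg (n := 2) (t := d) (by simpa using h2)
    have hquot : (m - 1) / (2 * b + d) ≤ (m + d) / 4 - 1 := by
      rw [div_le_iff₀ hpos]
      nlinarith [hm']
    calc 0 ≤ d ^ 2 * ((m + d) / 4 - 1 - (m - 1) / (2 * b + d)) :=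
          mul_nonneg (sq_nonneg d) (by linarith)
      _ = (m + d) * (1 - d / 2) ^ 2 - m + 2 * b * (m - 1) * d / (2 * b + d) := by
          field_simp
          ring
      _ ≤ _ := by gcongr; linarith
  · have hquot : m ≤ 2 * b * (m - 1) * d / (2 * b + d) := by
      rw [le_div_iff₀ hpos]
      nlinarith [mul_nonneg (by nlinarith : 0 ≤ 2 * b * (m - 1) - m) (by linarith : 0 ≤ d - 2)]
    have : 0 ≤ (m + d) * Real.exp (-d) := mul_nonneg (by linarith) (Real.exp_pos _).le
    linarith

namespace IsTangentStep

variable {a b c : ℝ}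

theorem profile_le (hab : IsTangentStep a b) (hb : 13 ≤ b) (hc : 0 < c) :
    (a + b) * (1 / b + Real.exp (-b) ^ 2) ≤
      (a + c) * (2 / (b + c) + Real.exp (-b) * Real.exp (-c)) := by
  have hdefect := tangent_defect_nonneg hb (m := a + b) (d := c - b)
    (by linarith [hab.le_add_one]) (by linarith [hab.le]) (by linarith)
  have hexp : Real.exp (-c) = Real.exp (-b) * Real.exp (-(c - b)) := by
    rw [← Real.exp_add]
    ring_nf
  have : 0 < b := by linarith
  have key : (a + c) * (2 / (b + c) + Real.exp (-b) * Real.exp (-c)) -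
      (a + b) * (1 / b + Real.exp (-b) ^ 2) = Real.exp (-b) ^ 2 *
        ((a + b + (c - b)) * Real.exp (-(c - b)) - (a + b) +
          2 * b * (a + b - 1) * (c - b) / (2 * b + (c - b))) := by
    have hfrac : (b - a) * (c - b) / (b * (b + c)) =
        Real.exp (-b) ^ 2 * (2 * b * (a + b - 1) * (c - b) / (2 * b + (c - b))) := by
      rw [hab.sub_eq, show 2 * b + (c - b) = b + c by ring]
      field_simp
    rw [mul_add (Real.exp (-b) ^ 2), ← hfrac, hexp]
    field_simp
    ring
  rw [← sub_nonneg, key]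
  positivity

end IsTangentStep

/-- The factor by which the vector at parameter `a` is scaled along a tangent step to `b`. -/
noncomputable def tangentScale (a b : ℝ) : ℝ :=
  2 / (a + b) / (1 / b + Real.exp (-b) ^ 2)

theorem tangentScale_pos {a b : ℝ} (ha : 0 < a) (hb : 0 < b) : 0 < tangentScale a b := by
  unfold tangentScale
  positivity

theorem tangentScale_mul {b : ℝ} (a : ℝ) (hb : 0 < b) :
    tangentScale a b * (1 / b + Real.exp (-b) ^ 2) = 2 / (a + b) :=
  div_mul_cancel₀ _ (by positivity)

namespace IsTangentStep

variable {a b c : ℝ}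

theorem two_div_le (hab : IsTangentStep a b) (ha : 0 < a) (hb : 13 ≤ b) (hc : 0 < c) :
    2 / (a + c) ≤ tangentScale a b * (2 / (b + c) + Real.exp (-b) * Real.exp (-c)) := by
  have : 0 < b := by linarith
  have hprofile := hab.profile_le hb hc
  rw [tangentScale, div_div, div_mul_eq_mul_div, div_le_div_iff₀ (by positivity) (by positivity)]
  linarith

theorem le_tangentScale_sq_div (hab : IsTangentStep a b) (ha : 1 ≤ a) :
    (1 - 2 * (1 / a - 1 / b)) / a ≤ tangentScale a b ^ 2 / b := by
  have hb : 1 ≤ b := ha.trans hab.le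
  have hε : 0 ≤ b - a := sub_nonneg.2 hab.le
  have hstep : 1 / a - 1 / b = (b - a) / (a * b) := by field_simp
  set E := b * Real.exp (-b) ^ 2 with hE
  have hE0 : 0 ≤ E := by positivity
  have hbern : 1 - 2 * E ≤ 1 / (1 + E) ^ 2 := by
    rw [le_div_iff₀ (by positivity)]
    nlinarith [pow_nonneg hE0 3, pow_nonneg hE0 2]
  have hE1 : 2 * E ≤ 1 / a - 1 / b := by
    have : b - a = 2 * b * (a + b - 1) * E := by rw [hab.sub_eq, hE]; ring
    rw [hstep, le_div_iff₀ (by positivity), this]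
    nlinarith [mul_nonneg (mul_nonneg (by linarith : 0 ≤ b) hE0) (by linarith : 0 ≤ b - 1)]
  have hsq : ((b - a) / (a + b)) ^ 2 ≤ 1 / a - 1 / b := by
    rw [hstep, div_pow]
    apply div_le_div₀ hε _ (by positivity) (by nlinarith)
    nlinarith [hab.le_add_one]
  have hscale : a * (tangentScale a b ^ 2 / b) =
      (1 - ((b - a) / (a + b)) ^ 2) * (1 / (1 + E) ^ 2) := by
    have : 1 / b + Real.exp (-b) ^ 2 = (1 + E) / b := by rw [hE]; field_simp
    have : a + b ≠ 0 := by positivity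
    rw [tangentScale, ‹1 / b + _ = _›]
    field_simp
    ring
  rw [div_le_iff₀' (by linarith), hscale]
  have hsq1 : ((b - a) / (a + b)) ^ 2 ≤ 1 := by
    refine pow_le_one₀ (by positivity) ((div_le_one (by positivity)).2 (by linarith))
  nlinarith [mul_le_mul_of_nonneg_left hbern (sub_nonneg.2 hsq1),
    mul_nonneg hE0 (sq_nonneg ((b - a) / (a + b)))]

end IsTangentStep

/-- Parameters `a k` obtained by successive tangent steps, with the products `r k` of the scaling
factors. The starting values make `r k • v (a k)` a unit vector for `k = 0` when
`‖v (a k)‖ ^ 2 = 1 / a k`. -/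
structure IsTangentSeq (a r : ℕ → ℝ) : Prop where
  param_zero : a 0 = 16
  scale_zero : r 0 = 4
  step (k : ℕ) : IsTangentStep (a k) (a (k + 1))
  scale_succ (k : ℕ) : r (k + 1) = r k * tangentScale (a k) (a (k + 1))

theorem exists_isTangentSeq : ∃ a r, IsTangentSeq a r := by
  choose! next hnext using fun (a : ℝ) (ha : 5 ≤ a) => exists_isTangentStep ha
  let a : ℕ → ℝ := fun k => next^[k] 16
  have ha : ∀ k, 5 ≤ a k := by
    intro k
    induction k with
    | zero => norm_num [a]
    | succ k ih =>
      simp only [a, Function.iterate_succ_apply']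
      exact ih.trans (hnext _ ih).le
  exact ⟨a, fun k => 4 * ∏ i ∈ Finset.range k, tangentScale (a i) (a (i + 1)), rfl, by simp,
    fun k => by simpa only [a, Function.iterate_succ_apply'] using hnext _ (ha k),
    fun k => by rw [Finset.prod_range_succ, mul_assoc]⟩

namespace IsTangentSeq

variable {a r : ℕ → ℝ}

theorem monotone (h : IsTangentSeq a r) : Monotone a :=
  monotone_nat_of_le_succ fun k => (h.step k).le

theorem sixteen_le (h : IsTangentSeq a r) (k : ℕ) : 16 ≤ a k :=
  h.param_zero ▸ h.monotone k.zero_le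

theorem param_pos (h : IsTangentSeq a r) (k : ℕ) : 0 < a k := by linarith [h.sixteen_le k]

theorem scale_pos (h : IsTangentSeq a r) (k : ℕ) : 0 < r k := by
  induction k with
  | zero => norm_num [h.scale_zero]
  | succ k ih =>
    rw [h.scale_succ]
    exact mul_pos ih (tangentScale_pos (h.param_pos k) (h.param_pos (k + 1)))

theorem tendsto_atTop (h : IsTangentSeq a r) : Tendsto a atTop atTop := by
  refine (tendsto_atTop_of_monotone h.monotone).resolve_right ?_
  rintro ⟨l, hl⟩
  have hl16 : 16 ≤ l := ge_of_tendsto' hl h.sixteen_le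
  have hl' := (tendsto_add_atTop_iff_nat 1).2 hl
  have hlim : l - l = 2 * l ^ 2 * (l + l - 1) * Real.exp (-l) ^ 2 := by
    refine tendsto_nhds_unique ((hl'.sub hl).congr fun k => (h.step k).sub_eq) ?_
    exact (((hl'.pow 2).const_mul 2).mul ((hl.add hl').sub_const 1)).mul
      (((Real.continuous_exp.tendsto _).comp hl'.neg).pow 2)
  have : 0 < l + l - 1 := by linarith
  have : 0 < 2 * l ^ 2 * (l + l - 1) * Real.exp (-l) ^ 2 := by positivity
  linarith

end IsTangentSeq

end TangentSteps

section WeakConvergence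

variable {H : Type*} [NormedAddCommGroup H] [InnerProductSpace ℝ H]
  {G : Type*} [NormedAddCommGroup G] [InnerProductSpace ℝ G] {s : ℕ → H} {x y : H}

theorem TendstoWeakly.map (hs : TendstoWeakly s x) (f : H →L[ℝ] G) :
    TendstoWeakly (fun k => f (s k)) (f x) :=
  ((WeakSpace.map f).continuous.tendsto _).comp hs

theorem TendstoWeakly.eq_of_tendsto (hs : TendstoWeakly s x) (hy : Tendsto s atTop (𝓝 y)) :
    x = y :=
  (toWeakSpace ℝ H).injective <|
    tendsto_nhds_unique hs (((toWeakSpaceCLM ℝ H).continuous.tendsto y).comp hy)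

theorem TendstoWeakly.convergesOnlyWeakly (hs : TendstoWeakly s 0) {c : ℝ} (hc : 0 < c)
    (hcs : ∀ k, c ≤ ‖s k‖ ^ 2) : ConvergesOnlyWeakly s 0 := by
  refine ⟨hs, fun ⟨y, hy⟩ => ?_⟩
  obtain rfl := hs.eq_of_tendsto hy
  simpa using hc.trans_le (ge_of_tendsto' (hy.norm.pow 2) hcs)

theorem ConvergesOnlyWeakly.map (hs : ConvergesOnlyWeakly s x) {f : H →L[ℝ] G} {g : G →L[ℝ] H}
    (hgf : Function.LeftInverse g f) : ConvergesOnlyWeakly (fun k => f (s k)) (f x) := by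
  refine ⟨hs.1.map f, fun ⟨y, hy⟩ => hs.2 ⟨g y, ?_⟩⟩
  simpa only [Function.comp_def, hgf _] using (g.continuous.tendsto y).comp hy

theorem ConvergesOnlyWeakly.prod_zero (hs : ConvergesOnlyWeakly s x) :
    ConvergesOnlyWeakly (fun k => WithLp.toLp 2 (s k, (0 : G))) (WithLp.toLp 2 (x, 0)) :=
  hs.map (f := (WithLp.prodContinuousLinearEquiv 2 ℝ H G).symm.toContinuousLinearMap ∘L
    ContinuousLinearMap.inl ℝ H G) (g := WithLp.fstL 2 ℝ H G) fun _ => rfl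

variable [CompleteSpace H]

theorem tendstoWeakly_of_forall_inner
    (h : ∀ y, Tendsto (fun k => ⟪s k, y⟫) atTop (𝓝 ⟪x, y⟫)) : TendstoWeakly s x := by
  refine (WeakBilin.tendsto_iff_forall_eval_tendsto (topDualPairing ℝ H).flip
    fun u v huv => ?_).2 fun f => ?_
  · exact ext_inner_left ℝ fun y => DFunLike.congr_fun huv (InnerProductSpace.toDual ℝ H y)
  · have hf (u : H) : f u = ⟪u, (InnerProductSpace.toDual ℝ H).symm f⟫ := by
      rw [real_inner_comm, InnerProductSpace.toDual_symm_apply]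
    have := h ((InnerProductSpace.toDual ℝ H).symm f)
    simp only [← hf] at this
    exact this

theorem tendstoWeakly_zero_of_forall_inner_self {C : ℝ} (hC : ∀ k, ‖s k‖ ≤ C)
    (h : ∀ j, Tendsto (fun k => ⟪s k, s j⟫) atTop (𝓝 0)) : TendstoWeakly s 0 := by
  let N : Submodule ℝ H :=
    { carrier := {y | Tendsto (fun k => ⟪s k, y⟫) atTop (𝓝 0)}
      zero_mem' := by simp
      add_mem' := fun hy hz => by simpa [inner_add_right] using hy.add hz
      smul_mem' := fun c y hy => by simpa [inner_smul_right] using hy.const_mul c }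
  have hN : IsClosed (N : Set H) := by
    have hlip (k : ℕ) : LipschitzWith C.toNNReal fun y => ⟪s k, y⟫ :=
      (innerSL ℝ (s k)).lipschitz.weaken <| by
        simpa [← NNReal.coe_le_coe, (norm_nonneg _).trans (hC k)] using hC k
    exact (LipschitzWith.uniformEquicontinuous _ _ hlip).equicontinuous.isClosed_setOfPred_tendsto
      continuous_const
  have hspan : (Submodule.span ℝ (Set.range s)).topologicalClosure ≤ N :=
    Submodule.topologicalClosure_minimal _ (Submodule.span_le.2 (Set.range_subset_iff.2 h)) hN
  refine tendstoWeakly_of_forall_inner fun y => ?_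
  obtain ⟨u, hu, v, hv, rfl⟩ :=
    (Submodule.span ℝ (Set.range s)).topologicalClosure.exists_add_mem_mem_orthogonal y
  have hvN : v ∈ N := by
    have (k : ℕ) : ⟪s k, v⟫ = 0 := hv _ <|
      Submodule.le_topologicalClosure _ (Submodule.subset_span (Set.mem_range_self k))
    simp [N, this]
  rw [inner_zero_left]
  exact N.add_mem (hspan hu) hvN

end WeakConvergence

section FirmlyNonexpansive

variable {H : Type*} [NormedAddCommGroup H]

/-- The operator whose resolvent is the single-valued map `J`. -/
def ofResolvent (J : H → H) : H → Set H := fun x => {v | J (x + v) = x}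

theorem resolventOp_ofResolvent (J : H → H) (x : H) : resolventOp (ofResolvent J) x = {J x} := by
  ext y
  simp [resolventOp, inv, addMap, ofResolvent, eq_comm]

theorem dom_ofResolvent_subset (J : H → H) : dom (ofResolvent J) ⊆ Set.range J :=
  fun x ⟨v, hv⟩ => ⟨x + v, hv⟩

theorem zero_mem_zer_ofResolvent {J : H → H} (hJ : J 0 = 0) : 0 ∈ zer (ofResolvent J) := by
  simpa [zer, ofResolvent] using hJ

variable [InnerProductSpace ℝ H]

/-- Firm nonexpansiveness `‖J p - J q‖² ≤ ⟪J p - J q, p - q⟫`, the property that characterizes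
the resolvents of monotone operators among all single-valued maps. -/
def IsFirmlyNonexpansive (J : H → H) : Prop :=
  ∀ p q, ‖J p - J q‖ ^ 2 ≤ ⟪J p - J q, p - q⟫

/-- `P` is the metric projection onto the convex set `K`, expressed through the variational
inequality that characterizes nearest points. -/
def IsProjection (K : Set H) (P : H → H) : Prop :=
  ∀ u, P u ∈ K ∧ ∀ w ∈ K, ⟪u - P u, w - P u⟫ ≤ 0

theorem exists_isProjection [CompleteSpace H] {K : Set H} (hne : K.Nonempty) (hcl : IsClosed K)
    (hconv : Convex ℝ K) : ∃ P : H → H, IsProjection K P := by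
  choose P hPK hP using fun u => exists_norm_eq_iInf_of_complete_convex hne hcl.isComplete hconv u
  exact ⟨P, fun u => ⟨hPK u, (norm_eq_iInf_iff_real_inner_le_zero hconv (hPK u)).1 (hP u)⟩⟩

namespace IsProjection

variable {K : Set H} {P : H → H}

theorem isFirmlyNonexpansive (hP : IsProjection K P) : IsFirmlyNonexpansive P := by
  intro p q
  have hp := (hP p).2 _ (hP q).1
  have hq := (hP q).2 _ (hP p).1
  rw [← neg_sub (P p) (P q), inner_neg_right] at hp
  have hsplit : ⟪P p - P q, p - q⟫ =
      ⟪p - P p, P p - P q⟫ - ⟪q - P q, P p - P q⟫ + ⟪P p - P q, P p - P q⟫ := by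
    rw [← inner_sub_left, ← inner_add_left, real_inner_comm]
    congr 1
    abel
  rw [← real_inner_self_eq_norm_sq]
  linarith

theorem eq_of_forall_inner_le (hP : IsProjection K P) {u v : H} (hv : v ∈ K)
    (h : ∀ w ∈ K, ⟪u - v, w - v⟫ ≤ 0) : P u = v := by
  have hPu := (hP u).2 _ hv
  have hvu := h _ (hP u).1
  rw [← neg_sub (P u) v, inner_neg_right] at hPu
  have hsplit : ‖P u - v‖ ^ 2 = ⟪u - v, P u - v⟫ - ⟪u - P u, P u - v⟫ := by
    rw [← inner_sub_left, sub_sub_sub_cancel_left, real_inner_self_eq_norm_sq]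
  exact sub_eq_zero.1 (norm_eq_zero.1 (sq_nonpos_iff _ |>.1 (by linarith)))

end IsProjection

theorem forall_mem_closedConvexHull_inner_le {S : Set H} {u : H} {c : ℝ}
    (h : ∀ w ∈ S, ⟪u, w⟫ ≤ c) : ∀ w ∈ closedConvexHull ℝ S, ⟪u, w⟫ ≤ c :=
  closedConvexHull_min (t := {w | ⟪u, w⟫ ≤ c}) h
    (convex_halfSpace_le (innerₗ H u).isLinear c)
    (isClosed_le (by fun_prop) continuous_const)

theorem IsFirmlyNonexpansive.fst_comp {G : Type*} [NormedAddCommGroup G] [InnerProductSpace ℝ G]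
    {P : WithLp 2 (H × G) → WithLp 2 (H × G)} (hP : IsFirmlyNonexpansive P) :
    IsFirmlyNonexpansive fun y => (P (WithLp.toLp 2 (y, 0))).fst := by
  intro p q
  have h := hP (WithLp.toLp 2 (p, 0)) (WithLp.toLp 2 (q, 0))
  rw [WithLp.prod_norm_sq_eq_of_L2, WithLp.prod_inner_apply] at h
  exact (le_add_of_nonneg_right (sq_nonneg _)).trans (h.trans_eq (by simp))

theorem IsFirmlyNonexpansive.isMaximallyMonotone {J : H → H} (hJ : IsFirmlyNonexpansive J) :
    IsMaximallyMonotone (ofResolvent J) := by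
  refine ⟨fun x y v w hv hw => ?_, fun A hA hsub => ?_⟩
  · have h := hJ (x + v) (y + w)
    rw [show J (x + v) = x from hv, show J (y + w) = y from hw, add_sub_add_comm,
      inner_add_right, real_inner_self_eq_norm_sq] at h
    linarith
  · refine funext fun x => Set.Subset.antisymm (fun v hv => ?_) (hsub x)
    let y := J (x + v)
    have hy : x + v - y ∈ A y := hsub y (by simp [ofResolvent, y])
    have hxy := hA hv hy
    rw [show v - (x + v - y) = -(x - y) by abel, inner_neg_right, real_inner_self_eq_norm_sq,
      neg_nonneg, sq_nonpos_iff, norm_eq_zero, sub_eq_zero] at hxy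
    exact hxy.symm

end FirmlyNonexpansive

section NormalSteps

variable {H : Type*} [NormedAddCommGroup H] [InnerProductSpace ℝ H] {x : ℕ → H} {h : ℕ → ℝ}

/-- The point `(x (k + 1), h k)` of the Hilbert space `H × ℝ`. -/
def liftedPoint (x : ℕ → H) (h : ℕ → ℝ) (k : ℕ) : WithLp 2 (H × ℝ) :=
  WithLp.toLp 2 (x (k + 1), h k)

/-- The closed convex hull of the origin and the lifted points. -/
def liftedHull (x : ℕ → H) (h : ℕ → ℝ) : Set (WithLp 2 (H × ℝ)) :=
  closedConvexHull ℝ (insert 0 (Set.range (liftedPoint x h)))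

theorem zero_mem_liftedHull : 0 ∈ liftedHull x h :=
  subset_closedConvexHull (Set.mem_insert _ _)

theorem liftedPoint_mem_liftedHull (k : ℕ) : liftedPoint x h k ∈ liftedHull x h :=
  subset_closedConvexHull (Set.mem_insert_of_mem _ (Set.mem_range_self k))

theorem inner_sub_liftedPoint (k j : ℕ) :
    ⟪WithLp.toLp 2 (x k, (0 : ℝ)) - liftedPoint x h k, liftedPoint x h j⟫ =
      ⟪x k - x (k + 1), x (j + 1)⟫ - h k * h j := by
  simp only [liftedPoint, WithLp.prod_inner_apply, WithLp.ofLp_sub, Prod.fst_sub,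
    Prod.snd_sub, zero_sub, RCLike.inner_apply, conj_trivial]
  ring

/-- Each step `x k - x (k + 1)`, completed by the height `-h k`, is normal to the hull of the
origin and the lifted points at `(x (k + 1), h k)`, so that `(x k, 0)` projects onto that point. -/
structure HasNormalSteps (x : ℕ → H) (h : ℕ → ℝ) : Prop where
  inner_le (k j : ℕ) : ⟪x k - x (k + 1), x (j + 1)⟫ ≤ h k * h j
  inner_eq (k : ℕ) : ⟪x k - x (k + 1), x (k + 1)⟫ = h k * h k

namespace HasNormalSteps

theorem inner_sub_liftedPoint_self (hx : HasNormalSteps x h) (k : ℕ) :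
    ⟪WithLp.toLp 2 (x k, (0 : ℝ)) - liftedPoint x h k, liftedPoint x h k⟫ = 0 := by
  rw [inner_sub_liftedPoint, hx.inner_eq, sub_self]

theorem norm_liftedPoint_le (hx : HasNormalSteps x h) (k : ℕ) : ‖liftedPoint x h k‖ ≤ ‖x k‖ := by
  have horth := hx.inner_sub_liftedPoint_self k
  rw [inner_sub_left, real_inner_self_eq_norm_mul_norm, sub_eq_zero] at horth
  have hcs := real_inner_le_norm (WithLp.toLp 2 (x k, (0 : ℝ))) (liftedPoint x h k)
  rw [horth, WithLp.norm_toLp_fst] at hcs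
  rcases (norm_nonneg (liftedPoint x h k)).eq_or_lt with h0 | hpos
  · exact h0 ▸ norm_nonneg _
  · exact le_of_mul_le_mul_right hcs hpos

theorem norm_le (hx : HasNormalSteps x h) (k : ℕ) : ‖x k‖ ≤ ‖x 0‖ :=
  antitone_nat_of_succ_le (f := fun k => ‖x k‖)
    (fun k => (WithLp.norm_fst_le _ (liftedPoint x h k)).trans (hx.norm_liftedPoint_le k)) k.zero_le

theorem isBounded_liftedHull (hx : HasNormalSteps x h) : Bornology.IsBounded (liftedHull x h) := by
  refine (Metric.isBounded_closedBall (x := 0) (r := ‖x 0‖)).subset <|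
    closedConvexHull_min (Set.insert_subset (by simp) (Set.range_subset_iff.2 fun k => ?_))
      (convex_closedBall _ _) Metric.isClosed_closedBall
  exact mem_closedBall_zero_iff.2 ((hx.norm_liftedPoint_le k).trans (hx.norm_le k))

theorem isProjection_apply (hx : HasNormalSteps x h)
    {P : WithLp 2 (H × ℝ) → WithLp 2 (H × ℝ)} (hP : IsProjection (liftedHull x h) P) (k : ℕ) :
    P (WithLp.toLp 2 (x k, 0)) = liftedPoint x h k := by
  refine hP.eq_of_forall_inner_le (liftedPoint_mem_liftedHull k) fun w hw => ?_
  rw [inner_sub_right, hx.inner_sub_liftedPoint_self, sub_zero]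
  refine forall_mem_closedConvexHull_inner_le ?_ w hw
  rintro _ (rfl | ⟨j, rfl⟩)
  · exact (inner_zero_right _).le
  · rw [inner_sub_liftedPoint]
    exact sub_nonpos.2 (hx.inner_le k j)

theorem exists_isFirmlyNonexpansive [CompleteSpace H] (hx : HasNormalSteps x h) :
    ∃ J : H → H, IsFirmlyNonexpansive J ∧ Bornology.IsBounded (Set.range J) ∧ J 0 = 0 ∧
      ∀ k, J (x k) = x (k + 1) := by
  obtain ⟨P, hP⟩ := exists_isProjection ⟨0, zero_mem_liftedHull (x := x) (h := h)⟩
    isClosed_closedConvexHull convex_closedConvexHull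
  have hP0 : P 0 = 0 := hP.eq_of_forall_inner_le zero_mem_liftedHull (by simp)
  have hbdd := (WithLp.fstL 2 ℝ H ℝ).lipschitz.isBounded_image hx.isBounded_liftedHull
  exact ⟨fun y => (P (WithLp.toLp 2 (y, 0))).fst, hP.isFirmlyNonexpansive.fst_comp,
    hbdd.subset (Set.range_subset_iff.2 fun y => Set.mem_image_of_mem _ (hP _).1),
    congrArg WithLp.fst hP0, fun k => congrArg WithLp.fst (hx.isProjection_apply hP k)⟩

end HasNormalSteps

end NormalSteps

section CauchyFamily

variable {H : Type*} [NormedAddCommGroup H] [InnerProductSpace ℝ H]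

theorem exists_ell2_inner_eq_inv_one_sub_mul :
    ∃ g : ℝ → Ell2, ∀ p q, |p| < 1 → |q| < 1 → ⟪g p, g q⟫ = (1 - p * q)⁻¹ := by
  have hmem {q : ℝ} (hq : |q| < 1) : Memℓp (fun n : ℕ => q ^ n) 2 := by
    refine memℓp_gen ((summable_geometric_of_abs_lt_one (r := q ^ 2) ?_).congr fun n => ?_)
    · rw [abs_pow]
      exact pow_lt_one₀ (abs_nonneg _) hq two_ne_zero
    · simp only [ENNReal.toReal_ofNat, Real.rpow_ofNat, Real.norm_eq_abs, sq_abs, pow_right_comm]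
  refine ⟨fun q => if hq : |q| < 1 then ⟨_, hmem hq⟩ else 0, fun p q hp hq => ?_⟩
  have hpq : |p * q| < 1 := by
    rw [abs_mul]
    exact mul_lt_one_of_nonneg_of_lt_one_left (abs_nonneg _) hp hq.le
  refine (lp.hasSum_inner (𝕜 := ℝ) _ _).unique
    ((hasSum_geometric_of_abs_lt_one hpq).congr_fun fun n => ?_)
  simp only [hp, hq, dif_pos, RCLike.inner_apply, conj_trivial, mul_pow, mul_comm]

/-- A family of vectors whose Gram kernel on the positive reals is the Cauchy kernel
`2 / (a + b)`, as for the functions `t ↦ exp (-a * t)` in `L²(0, ∞)` up to a constant factor. -/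
def IsCauchyFamily (v : ℝ → H) : Prop :=
  ∀ ⦃a b⦄, 0 < a → 0 < b → ⟪v a, v b⟫ = 2 / (a + b)

theorem exists_isCauchyFamily_ell2 : ∃ v : ℝ → Ell2, IsCauchyFamily v := by
  obtain ⟨g, hg⟩ := exists_ell2_inner_eq_inv_one_sub_mul
  -- The Cayley transform turns the Cauchy kernel into the kernel `1 / (1 - p * q)`.
  have hcayley {a : ℝ} (ha : 0 < a) : |(a - 1) / (a + 1)| < 1 := by
    rw [abs_div, abs_of_pos (by linarith : 0 < a + 1), div_lt_one (by linarith), abs_lt]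
    constructor <;> linarith
  refine ⟨fun a => (2 / (a + 1)) • g ((a - 1) / (a + 1)), fun a b ha hb => ?_⟩
  have hker : 1 - (a - 1) / (a + 1) * ((b - 1) / (b + 1)) =
      2 * (a + b) / ((a + 1) * (b + 1)) := by
    field_simp
    ring
  rw [real_inner_smul_left, real_inner_smul_right, hg _ _ (hcayley ha) (hcayley hb), hker]
  field_simp

theorem exists_linearIsometry_ell2 [CompleteSpace H] (hH : ¬ FiniteDimensional ℝ H) :
    Nonempty (Ell2 →ₗᵢ[ℝ] H) := by
  obtain ⟨w, b, _⟩ := exists_hilbertBasis ℝ H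
  have : Infinite w := not_finite_iff_infinite.1 fun _ => by
    have := Fintype.ofFinite w
    exact hH b.toOrthonormalBasis.toBasis.finiteDimensional_of_finite
  exact ⟨(b.orthonormal.comp _ (Infinite.natEmbedding w).injective).orthogonalFamily.linearIsometry⟩

theorem exists_isCauchyFamily [CompleteSpace H] (hH : ¬ FiniteDimensional ℝ H) :
    ∃ v : ℝ → H, IsCauchyFamily v := by
  obtain ⟨f⟩ := exists_linearIsometry_ell2 hH
  obtain ⟨v, hv⟩ := exists_isCauchyFamily_ell2
  exact ⟨fun a => f (v a), fun a b ha hb => (f.inner_map_map _ _).trans (hv ha hb)⟩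

theorem not_finiteDimensional_ell2 : ¬ FiniteDimensional ℝ Ell2 := fun _ => by
  let b : HilbertBasis ℕ ℝ Ell2 := HilbertBasis.ofRepr (LinearIsometryEquiv.refl ℝ Ell2)
  have := b.orthonormal.linearIndependent.finite_of_isNoetherian
  exact not_finite ℕ

end CauchyFamily

section TangentOrbit

variable {H : Type*} [NormedAddCommGroup H] [InnerProductSpace ℝ H]
  {v : ℝ → H} {a r : ℕ → ℝ}

namespace IsTangentSeq

theorem inner_smul_smul (h : IsTangentSeq a r) (hv : IsCauchyFamily v) (j k : ℕ) :
    ⟪r j • v (a j), r k • v (a k)⟫ = r j * r k * (2 / (a j + a k)) := by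
  rw [real_inner_smul_left, real_inner_smul_right, hv (h.param_pos j) (h.param_pos k), mul_assoc]

theorem norm_smul_sq (h : IsTangentSeq a r) (hv : IsCauchyFamily v) (k : ℕ) :
    ‖r k • v (a k)‖ ^ 2 = r k ^ 2 / a k := by
  have := h.param_pos k
  rw [← real_inner_self_eq_norm_sq, h.inner_smul_smul hv]
  field_simp
  ring

theorem hasNormalSteps (h : IsTangentSeq a r) (hv : IsCauchyFamily v) :
    HasNormalSteps (fun k => r k • v (a k)) fun k => r (k + 1) * Real.exp (-a (k + 1)) where
  inner_le k j := by
    have hstep := mul_le_mul_of_nonneg_left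
      ((h.step k).two_div_le (h.param_pos k) (by linarith [h.sixteen_le (k + 1)])
        (h.param_pos (j + 1)))
      (mul_pos (h.scale_pos k) (h.scale_pos (j + 1))).le
    rw [inner_sub_left, h.inner_smul_smul hv, h.inner_smul_smul hv, sub_le_iff_le_add]
    refine hstep.trans_eq ?_
    rw [h.scale_succ k]
    ring
  inner_eq k := by
    have hstep := congrArg (r k * r (k + 1) * ·)
      (tangentScale_mul (a k) (h.param_pos (k + 1)))
    have := h.param_pos (k + 1)
    rw [inner_sub_left, h.inner_smul_smul hv, h.inner_smul_smul hv, ← hstep, h.scale_succ k]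
    field_simp
    ring

theorem norm_smul_le_one (h : IsTangentSeq a r) (hv : IsCauchyFamily v) (k : ℕ) :
    ‖r k • v (a k)‖ ≤ 1 := by
  refine ((h.hasNormalSteps hv).norm_le k).trans ((sq_le_one_iff₀ (norm_nonneg _)).1 ?_)
  rw [h.norm_smul_sq hv, h.scale_zero, h.param_zero]
  norm_num

theorem scale_sq_div_param_le_one (h : IsTangentSeq a r) (hv : IsCauchyFamily v) (k : ℕ) :
    r k ^ 2 / a k ≤ 1 :=
  h.norm_smul_sq hv k ▸ pow_le_one₀ (norm_nonneg _) (h.norm_smul_le_one hv k)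

theorem monotone_scale_sq_div_sub (h : IsTangentSeq a r) (hv : IsCauchyFamily v) :
    Monotone fun k => r k ^ 2 / a k - 2 / a k := monotone_nat_of_le_succ fun k => by
  have hδ : 0 ≤ 2 * (1 / a k - 1 / a (k + 1)) := by
    have := one_div_le_one_div_of_le (h.param_pos k) (h.step k).le
    linarith
  calc r k ^ 2 / a k - 2 / a k
      ≤ r k ^ 2 / a k * (1 - 2 * (1 / a k - 1 / a (k + 1))) - 2 / a (k + 1) := by
        have := mul_le_of_le_one_left hδ (h.scale_sq_div_param_le_one hv k)
        linarith [div_eq_mul_one_div 2 (a k), div_eq_mul_one_div 2 (a (k + 1))]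
    _ = r k ^ 2 * ((1 - 2 * (1 / a k - 1 / a (k + 1))) / a k) - 2 / a (k + 1) := by ring
    _ ≤ r k ^ 2 * (tangentScale (a k) (a (k + 1)) ^ 2 / a (k + 1)) - 2 / a (k + 1) := by
        gcongr r k ^ 2 * ?_ - _
        exact (h.step k).le_tangentScale_sq_div (by linarith [h.sixteen_le k])
    _ = r (k + 1) ^ 2 / a (k + 1) - 2 / a (k + 1) := by
        rw [h.scale_succ k]
        ring

theorem seven_eighths_le_norm_smul_sq (h : IsTangentSeq a r) (hv : IsCauchyFamily v) (k : ℕ) :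
    7 / 8 ≤ ‖r k • v (a k)‖ ^ 2 := by
  have hmono := h.monotone_scale_sq_div_sub hv k.zero_le
  have : 0 < 2 / a k := div_pos two_pos (h.param_pos k)
  simp only [h.scale_zero, h.param_zero] at hmono
  rw [h.norm_smul_sq hv]
  linarith

theorem tendsto_inner_zero (h : IsTangentSeq a r) (hv : IsCauchyFamily v) (j : ℕ) :
    Tendsto (fun k => ⟪r k • v (a k), r j • v (a j)⟫) atTop (𝓝 0) := by
  have hr (k : ℕ) : r k ≤ √(a k) := Real.le_sqrt_of_sq_le <|
    (div_le_one (h.param_pos k)).1 (h.scale_sq_div_param_le_one hv k)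
  have hlim : Tendsto (fun k => 2 * r j / √(a k)) atTop (𝓝 0) :=
    (Real.tendsto_sqrt_atTop.comp h.tendsto_atTop).const_div_atTop _
  refine squeeze_zero (fun k => ?_) (fun k => ?_) hlim
  all_goals
    have hj := h.param_pos j
    have hk := h.param_pos k
    have hrj := h.scale_pos j
    have hrk := h.scale_pos k
    rw [h.inner_smul_smul hv]
  · positivity
  · calc r k * r j * (2 / (a k + a j)) ≤ √(a k) * r j * (2 / a k) := by
          gcongr
          · exact hr k
          · linarith
      _ = 2 * r j * (√(a k) / a k) := by ring
      _ = 2 * r j / √(a k) := by rw [Real.sqrt_div_self', mul_one_div]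

end IsTangentSeq

theorem exists_isFirmlyNonexpansive_convergesOnlyWeakly [CompleteSpace H]
    (hH : ¬ FiniteDimensional ℝ H) :
    ∃ (J : H → H) (x₀ : H), IsFirmlyNonexpansive J ∧ Bornology.IsBounded (Set.range J) ∧
      J 0 = 0 ∧ ConvergesOnlyWeakly (fun k => J^[k] x₀) 0 := by
  obtain ⟨v, hv⟩ := exists_isCauchyFamily hH
  obtain ⟨a, r, h⟩ := exists_isTangentSeq
  obtain ⟨J, hJ, hbdd, hJ0, hJx⟩ := (h.hasNormalSteps hv).exists_isFirmlyNonexpansive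
  have hiterate (k : ℕ) : J^[k] (r 0 • v (a 0)) = r k • v (a k) := by
    induction k with
    | zero => rfl
    | succ k ih => rw [Function.iterate_succ_apply', ih, hJx]
  refine ⟨J, r 0 • v (a 0), hJ, hbdd, hJ0, ?_⟩
  simp only [hiterate]
  exact (tendstoWeakly_zero_of_forall_inner_self (h.norm_smul_le_one hv)
    (h.tendsto_inner_zero hv)).convergesOnlyWeakly (by norm_num)
      (h.seven_eighths_le_norm_smul_sq hv)

end TangentOrbit

section Splitting

theorem mem_image_toLp_zero {X Y : Type*} [Zero Y] {S : Set X} {z : WithLp 2 (X × Y)} :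
    z ∈ (fun x => WithLp.toLp 2 (x, (0 : Y))) '' S ↔ z.fst ∈ S ∧ z.snd = 0 := by
  constructor
  · rintro ⟨x, hx, rfl⟩
    exact ⟨hx, rfl⟩
  · rintro ⟨hz, h0⟩
    exact ⟨z.fst, hz, by rw [← h0]; rfl⟩

variable {X : Type*} [NormedAddCommGroup X] [InnerProductSpace ℝ X]
  {Y : Type*} [NormedAddCommGroup Y] [InnerProductSpace ℝ Y]

theorem mem_zer_scale {A : X → Set X} {x : X} (hx : x ∈ zer A) (c : ℝ) : x ∈ zer (scale c A) :=
  ⟨0, hx, smul_zero c⟩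

theorem ConvergesOnlyWeakly.iterate_prod_zero {J : X → X}
    {T : WithLp 2 (X × Y) → WithLp 2 (X × Y)} {x₀ x : X}
    (h : ConvergesOnlyWeakly (fun k => J^[k] x₀) x)
    (hT : ∀ x, T (WithLp.toLp 2 (x, 0)) = WithLp.toLp 2 (J x, 0)) :
    ConvergesOnlyWeakly (fun k => T^[k] (WithLp.toLp 2 (x₀, 0))) (WithLp.toLp 2 (x, 0)) := by
  have hsemi : Function.Semiconj (fun x => WithLp.toLp 2 (x, (0 : Y))) J T := fun x => (hT x).symm
  simpa only [(hsemi.iterate_right _).eq] using h.prod_zero (G := Y)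

variable [CompleteSpace X] [CompleteSpace Y]

theorem mem_zer_primalDualOp (L : X →L[ℝ] Y) {A : X → Set X} {x : X} (hx : x ∈ zer A) :
    WithLp.toLp 2 (x, 0) ∈ zer (primalDualOp L A (zeroOp Y)) := by
  simp only [zer, Set.mem_ofPred_eq] at hx
  simpa [zer, primalDualOp, inv, zeroOp] using hx

theorem adjoint_drC (z : WithLp 2 (X × X)) : (drC X).adjoint z = z.fst - z.snd := by
  refine ext_inner_right ℝ fun w => ?_
  rw [ContinuousLinearMap.adjoint_inner_left, show drC X w = WithLp.toLp 2 (w, -w) from rfl,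
    WithLp.prod_inner_apply, inner_sub_left]
  simp [sub_eq_add_neg]

theorem inv_addMap_drM_drC (A : X → Set X) (w : X) :
    inv (addMap (drM X) (drA A (zeroOp X))) (drC X w) =
      (fun x => WithLp.toLp 2 (x, 0)) '' resolventOp A w := by
  ext z
  have hmem : z ∈ inv (addMap (drM X) (drA A (zeroOp X))) (drC X w) ↔
      w - (drC X).adjoint z - z.snd ∈ A z.fst ∧ z.snd = 0 := by
    simp only [inv, addMap, drA, primalDualOp, zeroOp, Set.mem_ofPred_eq, Set.mem_singleton_iff,
      ContinuousLinearMap.adjoint_id]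
    rfl
  rw [hmem, mem_image_toLp_zero, adjoint_drC, sub_sub, sub_add_cancel]
  rfl

theorem pppOp_drM (A : X → Set X) (z : WithLp 2 (X × X)) :
    pppOp (drM X) (drA A (zeroOp X)) z =
      (fun x => WithLp.toLp 2 (x, 0)) '' resolventOp A (z.fst - z.snd) := by
  rw [← inv_addMap_drM_drC, ← adjoint_drC]
  rfl

theorem reducedOp_drC (A : X → Set X) (w : X) :
    reducedOp (drC X) (drA A (zeroOp X)) w = resolventOp A w := by
  change (drC X).adjoint '' inv (addMap (drM X) (drA A (zeroOp X))) (drC X w) = _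
  rw [inv_addMap_drM_drC, Set.image_image]
  simp [adjoint_drC]

theorem pppOp_cpM (A : X → Set X) (L : X →L[ℝ] Y) {σ : ℝ} (hσ : σ ≠ 0) (τ : ℝ)
    (z : WithLp 2 (X × Y)) :
    pppOp (cpM L σ τ) (primalDualOp L (scale σ⁻¹ A) (zeroOp Y)) z =
      (fun x => WithLp.toLp 2 (x, 0)) '' resolventOp A (z.fst - σ • L.adjoint z.snd) := by
  ext z'
  have hmem : z' ∈ pppOp (cpM L σ τ) (primalDualOp L (scale σ⁻¹ A) (zeroOp Y)) z ↔
      (∃ v ∈ A z'.fst, σ⁻¹ • v = (σ⁻¹ • z.fst - L.adjoint z.snd)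
        - (σ⁻¹ • z'.fst - L.adjoint z'.snd) - L.adjoint z'.snd) ∧ z'.snd = 0 := by
    simp only [pppOp, inv, addMap, primalDualOp, scale, zeroOp, Set.mem_ofPred_eq,
      Set.mem_singleton_iff]
    rfl
  have hsolve (v : X) : σ⁻¹ • v = (σ⁻¹ • z.fst - L.adjoint z.snd)
        - (σ⁻¹ • z'.fst - L.adjoint z'.snd) - L.adjoint z'.snd ↔
      v = z.fst - σ • L.adjoint z.snd - z'.fst := by
    rw [inv_smul_eq_iff₀ hσ, sub_sub, sub_add_cancel, smul_sub, smul_sub, smul_inv_smul₀ hσ,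
      smul_inv_smul₀ hσ]
  rw [hmem, mem_image_toLp_zero]
  simp only [hsolve, exists_eq_right]
  rfl

end Splitting

end MonotoneOp

open MonotoneOp in
theorem proposition2p4_general {H : Type*} [NormedAddCommGroup H] [InnerProductSpace ℝ H]
    [CompleteSpace H] (hH : ¬ FiniteDimensional ℝ H) :
    ∃ (B : H → Set H) (J : H → H) (s₀ sbar : H),
      IsMaximallyMonotone B ∧ Bornology.IsBounded (dom B) ∧
      (∀ x, resolventOp B x = {J x}) ∧
      sbar ∈ zer B ∧ ConvergesOnlyWeakly (fun k => J^[k] s₀) sbar ∧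
      (∃ (T : WithLp 2 (H × H) → WithLp 2 (H × H)) (Tred : H → H),
        (∀ z, pppOp (drM H) (drA B (zeroOp H)) z = {T z}) ∧
        (∀ w, reducedOp (drC H) (drA B (zeroOp H)) w = {Tred w}) ∧
        WithLp.toLp 2 (sbar, 0) ∈ zer (drA B (zeroOp H)) ∧
        ConvergesOnlyWeakly (fun k => T^[k] (WithLp.toLp 2 (s₀, 0))) (WithLp.toLp 2 (sbar, 0)) ∧
        ConvergesOnlyWeakly (fun k => Tred^[k] ((drC H).adjoint (WithLp.toLp 2 (s₀, 0)))) sbar) ∧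
      (∀ (Y : Type u) [NormedAddCommGroup Y] [InnerProductSpace ℝ Y] [CompleteSpace Y]
        (L : H →L[ℝ] Y) (σ τ : ℝ), σ ≠ 0 → τ ≠ 0 →
        ∃ T : WithLp 2 (H × Y) → WithLp 2 (H × Y),
          (∀ z, pppOp (cpM L σ τ) (primalDualOp L (scale σ⁻¹ B) (zeroOp Y)) z = {T z}) ∧
          WithLp.toLp 2 (sbar, 0) ∈ zer (primalDualOp L (scale σ⁻¹ B) (zeroOp Y)) ∧
          ConvergesOnlyWeakly (fun k => T^[k] (WithLp.toLp 2 (s₀, 0)))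
            (WithLp.toLp 2 (sbar, 0))) := by
  obtain ⟨J, x₀, hJ, hbdd, hJ₀, hconv⟩ := exists_isFirmlyNonexpansive_convergesOnlyWeakly hH
  have hres := resolventOp_ofResolvent J
  have hzer := zero_mem_zer_ofResolvent hJ₀
  refine ⟨ofResolvent J, J, x₀, 0, hJ.isMaximallyMonotone,
    hbdd.subset (dom_ofResolvent_subset J), hres, hzer, hconv,
    ⟨fun z => WithLp.toLp 2 (J (z.fst - z.snd), 0), J, fun z => ?_, fun w => ?_,
      mem_zer_primalDualOp _ hzer, hconv.iterate_prod_zero fun x => ?_, ?_⟩,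
    fun Y _ _ _ L σ τ hσ _ => ⟨fun z => WithLp.toLp 2 (J (z.fst - σ • L.adjoint z.snd), 0),
      fun z => ?_, mem_zer_primalDualOp L (mem_zer_scale hzer _),
      hconv.iterate_prod_zero fun x => ?_⟩⟩
  · rw [pppOp_drM, hres, Set.image_singleton]
  · rw [reducedOp_drC, hres]
  · simp
  · simpa [adjoint_drC] using hconv
  · rw [pppOp_cpM _ L hσ, hres, Set.image_singleton]
  · simp

open MonotoneOp in
theorem proposition2p4 :
    ∃ (B : Ell2 → Set Ell2) (J : Ell2 → Ell2) (s₀ sbar : Ell2),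
      IsMaximallyMonotone B ∧ Bornology.IsBounded (dom B) ∧
      (∀ x, resolventOp B x = {J x}) ∧
      sbar ∈ zer B ∧ ConvergesOnlyWeakly (fun k => J^[k] s₀) sbar ∧
      -- Douglas-Rachford with `A₁ = B`, `A₂ = 0`
      (∃ (T : WithLp 2 (Ell2 × Ell2) → WithLp 2 (Ell2 × Ell2)) (Tred : Ell2 → Ell2),
        (∀ z, pppOp (drM Ell2) (drA B (zeroOp Ell2)) z = {T z}) ∧
        (∀ w, reducedOp (drC Ell2) (drA B (zeroOp Ell2)) w = {Tred w}) ∧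
        WithLp.toLp 2 (sbar, 0) ∈ zer (drA B (zeroOp Ell2)) ∧
        ConvergesOnlyWeakly (fun k => T^[k] (WithLp.toLp 2 (s₀, 0)))
          (WithLp.toLp 2 (sbar, 0)) ∧
        ConvergesOnlyWeakly (fun k => Tred^[k] ((drC Ell2).adjoint (WithLp.toLp 2 (s₀, 0))))
          sbar) ∧
      -- Chambolle-Pock with `A₁ = σ⁻¹ B`, `A₂ = 0`
      (∀ (Y : Type u) [NormedAddCommGroup Y] [InnerProductSpace ℝ Y] [CompleteSpace Y]
        (L : Ell2 →L[ℝ] Y) (σ τ : ℝ), 0 < σ → 0 < τ → σ * τ * ‖L‖ ^ 2 ≤ 1 →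
        ∃ T : WithLp 2 (Ell2 × Y) → WithLp 2 (Ell2 × Y),
          (∀ z, pppOp (cpM L σ τ) (primalDualOp L (scale σ⁻¹ B) (zeroOp Y)) z = {T z}) ∧
          WithLp.toLp 2 (sbar, 0) ∈ zer (primalDualOp L (scale σ⁻¹ B) (zeroOp Y)) ∧
          ConvergesOnlyWeakly (fun k => T^[k] (WithLp.toLp 2 (s₀, 0)))
            (WithLp.toLp 2 (sbar, 0))) := by
  obtain ⟨B, J, s₀, sbar, hB, hdom, hres, hzer, hconv, hDR, hCP⟩ :=
    proposition2p4_general not_finiteDimensional_ell2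
  exact ⟨B, J, s₀, sbar, hB, hdom, hres, hzer, hconv, hDR,
    fun Y _ _ _ L σ τ hσ hτ _ => hCP Y L σ τ hσ.ne' hτ.ne'⟩
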